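/- For integers $k\ge 1$ and $d\ge 2$, let $\mathrm{LCS}(X^1,\dots,X^d)$ denote the length of the longest common (not necessarily contiguous) subsequence of the strings $X^1,\dots,X^d$, and let $$\gamma_{k,d}=\lim_{n\to\infty}\frac{\mathbb{E}\left[\mathrm{LCS}(X^1,\dots,X^d)\right]}{n},$$ where $X^1,\dots,X^d$ are independent uniformly random strings of length $n$ over an alphabet of size $k$ (the generalized Chvátal–Sankoff constant). There are absolute constants $0<c_1<c_2$ such that for every integer $d\ge 2$ the limit defining $\gamma_{2,d}$ exists and $$\frac12+\frac{c_1}{\sqrt d}\le \gamma_{2,d}\le \frac12+\frac{c_2}{\sqrt d}.$$ -/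

import Mathlib

open Filter Topology

/-- `lcs X` is the length of a longest common subsequence of the strings `X i`, i.e. the largest
length of a string `w` that is a (not necessarily contiguous) subsequence of every `X i`. For a
nonempty family the set of lengths below is bounded, and it always contains `0`. -/
noncomputable def lcs {ι α : Type*} (X : ι → List α) : ℕ :=
  sSup {m : ℕ | ∃ w : List α, w.length = m ∧ ∀ i, w.Sublist (X i)}

/-- The expected length of the longest common subsequence of `d` independent uniformly random
strings of length `n` over an alphabet of size `k`: the average of `lcs` over all `d`-tuples of
strings of length `n`. -/
noncomputable def expectedLCS (k d n : ℕ) : ℝ :=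
  (∑ X : Fin d → Fin n → Fin k, (lcs (fun i => List.ofFn (X i)) : ℝ)) /
    (Fintype.card (Fin d → Fin n → Fin k) : ℝ)

/-- The generalized Chvátal–Sankoff constant `γ_{k,d}`, the limit of the normalized expected
length of the longest common subsequence. -/
noncomputable def chvatalSankoff (k d : ℕ) : ℝ :=
  limUnder atTop (fun n : ℕ => expectedLCS k d n / (n : ℝ))

open Finset BigOperators

/-! ### Common subsequences and concatenation -/

section LongestCommonSubsequence

variable {ι α : Type*}

/-! Concatenation makes the expected LCS superadditive, so Fekete's lemma gives the limit. Upper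
bound: a union bound over the `2 ^ m` candidate words. The number of length-`n` superwords of a word
depends only on its length and is controlled by a generating function
(`card_superwords_mul_pow_le`). With `m` about `(1/2 + 1/√d) n`, a random word contains a given
candidate with probability at most `exp (-c n / d)`, where `c` is large enough for the `d`-th power
to beat `2 ^ m`. Lower bound: match greedily. Look at the next letter of every word and take the
majority letter; each dissenting word reads on until that letter appears. A letter agrees with the
majority with probability at least `1/2 + ε`, `ε` of order `1/√d`, by a Khinchine inequality
(`le_expect_majority_agreement`). Agreement uses one letter and dissent three on average, hence at
most `2 - 2ε` letters per match and a rate above `1/2 + ε/4`. An exponential potential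
(`failureProb_le`) controls the chance that some word runs out. -/

theorem bddAbove_commonSubsequence_lengths [Nonempty ι] (X : ι → List α) :
    BddAbove {m : ℕ | ∃ w : List α, w.length = m ∧ ∀ i, w.Sublist (X i)} := by
  refine ⟨(X (Classical.arbitrary ι)).length, ?_⟩
  rintro m ⟨w, rfl, hw⟩
  exact (hw _).length_le

theorem length_le_lcs [Nonempty ι] {X : ι → List α} {w : List α} (hw : ∀ i, w.Sublist (X i)) :
    w.length ≤ lcs X :=
  le_csSup (bddAbove_commonSubsequence_lengths X) ⟨w, rfl, hw⟩

theorem exists_length_eq_lcs [Nonempty ι] (X : ι → List α) :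
    ∃ w : List α, w.length = lcs X ∧ ∀ i, w.Sublist (X i) :=
  Nat.sSup_mem (s := {m : ℕ | ∃ w : List α, w.length = m ∧ ∀ i, w.Sublist (X i)})
    ⟨0, [], rfl, fun _ => List.nil_sublist _⟩ (bddAbove_commonSubsequence_lengths X)

theorem le_lcs_iff [Nonempty ι] {X : ι → List α} {m : ℕ} :
    m ≤ lcs X ↔ ∃ w : List α, w.length = m ∧ ∀ i, w.Sublist (X i) := by
  constructor
  · intro h
    obtain ⟨w, hw, hX⟩ := exists_length_eq_lcs X
    exact ⟨w.take m, by simp [hw, h], fun i => (List.take_sublist _ _).trans (hX i)⟩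
  · rintro ⟨w, rfl, hw⟩
    exact length_le_lcs hw

theorem lcs_le_length [Nonempty ι] (X : ι → List α) (i : ι) : lcs X ≤ (X i).length := by
  obtain ⟨w, hw, hX⟩ := exists_length_eq_lcs X
  exact hw ▸ (hX i).length_le

theorem lcs_add_le_lcs_append [Nonempty ι] (X Y : ι → List α) :
    lcs X + lcs Y ≤ lcs (fun i => X i ++ Y i) := by
  obtain ⟨v, hv, hX⟩ := exists_length_eq_lcs X
  obtain ⟨w, hw, hY⟩ := exists_length_eq_lcs Y
  rw [← hv, ← hw, ← List.length_append]
  exact length_le_lcs fun i => (hX i).append (hY i)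

end LongestCommonSubsequence

/-! ### Uniform averages over families of words -/

section Words

variable (α : Type*) [Fintype α]

/-- The finite set of all words of length `m` over `α`. -/
def words (m : ℕ) : Finset (List α) :=
  (univ : Finset (Fin m → α)).map ⟨List.ofFn, List.ofFn_injective⟩

variable {α}

@[simp]
theorem mem_words {m : ℕ} {w : List α} : w ∈ words α m ↔ w.length = m := by
  constructor
  · intro h
    obtain ⟨x, -, rfl⟩ := Finset.mem_map.1 h
    simp
  · rintro rfl
    exact Finset.mem_map.2 ⟨w.get, mem_univ _, by simp⟩

theorem card_words (m : ℕ) : #(words α m) = Fintype.card α ^ m := by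
  simp [words]

theorem words_nonempty [Nonempty α] (m : ℕ) : (words α m).Nonempty := by
  rw [← card_pos, card_words]
  positivity

variable (α)

/-- The finite set of families of words over `α` with prescribed lengths. -/
def tuples {ι : Type*} [Fintype ι] [DecidableEq ι] (n : ι → ℕ) : Finset (ι → List α) :=
  Fintype.piFinset fun i => words α (n i)

variable {α} {ι : Type*} [Fintype ι] [DecidableEq ι]

@[simp]
theorem mem_tuples {n : ι → ℕ} {Y : ι → List α} :
    Y ∈ tuples α n ↔ ∀ i, (Y i).length = n i := by
  simp [tuples]

theorem tuples_nonempty [Nonempty α] (n : ι → ℕ) : (tuples α n).Nonempty :=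
  Fintype.piFinset_nonempty.2 fun i => words_nonempty (n i)

/-- Averaging over all families of words may be done by first exposing the first letter of one
of the words. -/
theorem expect_tuples_cons_update {n : ι → ℕ} {i : ι} (hi : n i ≠ 0) (f : (ι → List α) → ℝ) :
    𝔼 Y ∈ tuples α n, f Y =
      𝔼 b : α, 𝔼 Y ∈ tuples α (Function.update n i (n i - 1)),
        f (Function.update Y i (b :: Y i)) := by
  rw [← expect_product']
  symm
  refine expect_nbij (fun p => Function.update p.2 i (p.1 :: p.2 i)) ?_ (fun _ _ => rfl) ?_ ?_
  · rintro ⟨b, Y⟩ hY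
    simp only [mem_product, mem_univ, true_and, mem_tuples] at hY
    rw [mem_tuples]
    intro j
    have := hY j
    rcases eq_or_ne j i with rfl | hj
    · simp only [Function.update_self, List.length_cons] at this ⊢
      omega
    · simpa [hj] using this
  · rintro ⟨b, Y⟩ - ⟨c, Z⟩ - h
    simp only at h
    have h1 := congrFun h i
    simp only [Function.update_self, List.cons.injEq] at h1
    refine Prod.ext h1.1 (funext fun j => ?_)
    rcases eq_or_ne j i with rfl | hj
    · exact h1.2
    · simpa [hj] using congrFun h j
  · intro Y hY
    rw [mem_coe, mem_tuples] at hY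
    obtain ⟨b, y, hy⟩ : ∃ b y, Y i = b :: y := by
      refine List.exists_cons_of_ne_nil fun h => hi ?_
      rw [← hY i, h, List.length_nil]
    refine ⟨(b, Function.update Y i y), ?_, ?_⟩
    · simp only [coe_product, Set.mem_prod, mem_coe, mem_univ, true_and, mem_tuples]
      intro j
      have := hY j
      rcases eq_or_ne j i with rfl | hj
      · simp only [Function.update_self, ← this, hy, List.length_cons, Nat.add_sub_cancel]
      · simpa [hj] using this
    · simp [← hy]

/-- Averaging over all families of nonempty words may be done by first exposing all the first
letters. -/
theorem expect_tuples_cons (n : ι → ℕ) (f : (ι → List α) → ℝ) :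
    𝔼 Y ∈ tuples α (fun i => n i + 1), f Y =
      𝔼 b : ι → α, 𝔼 Y ∈ tuples α n, f (fun i => b i :: Y i) := by
  rw [← expect_product']
  symm
  refine expect_nbij (fun p i => p.1 i :: p.2 i) ?_ (fun _ _ => rfl) ?_ ?_
  · rintro ⟨b, Y⟩ hY
    simpa using hY
  · rintro ⟨b, Y⟩ - ⟨c, Z⟩ - h
    have h1 := fun i => List.cons.inj (congrFun h i)
    exact Prod.ext (funext fun i => (h1 i).1) (funext fun i => (h1 i).2)
  · intro Y hY
    rw [mem_coe, mem_tuples] at hY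
    have h : ∀ i, ∃ b y, Y i = b :: y := fun i => by
      refine List.exists_cons_of_ne_nil fun h => ?_
      simpa [h] using hY i
    choose b y h using h
    exact ⟨(b, y), by simpa [h] using hY, funext fun i => (h i).symm⟩

/-- A uniformly random family of words is a concatenation of two independent ones. -/
theorem expect_tuples_append (m n : ι → ℕ) (f : (ι → List α) → ℝ) :
    𝔼 Z ∈ tuples α (fun i => m i + n i), f Z =
      𝔼 X ∈ tuples α m, 𝔼 Y ∈ tuples α n, f (fun i => X i ++ Y i) := by
  rw [← expect_product']
  refine expect_nbij' (fun Z => (fun i => (Z i).take (m i), fun i => (Z i).drop (m i)))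
    (fun p i => p.1 i ++ p.2 i) ?_ ?_ ?_ ?_ ?_
  · intro Z hZ
    simp only [mem_tuples] at hZ
    simp [hZ]
  · rintro ⟨X, Y⟩ h
    simp only [mem_product, mem_tuples] at h
    simp [h]
  · intro Z _
    simp
  · rintro ⟨X, Y⟩ h
    simp only [mem_product, mem_tuples] at h
    simp [← h.1]
  · intro Z _
    simp

end Words

/-! ### Superadditivity and existence of the limit -/

section ExpectedLCS

variable (k : ℕ) {d : ℕ}

theorem expectedLCS_eq_expect_tuples (d n : ℕ) :
    expectedLCS k d n = 𝔼 Y ∈ tuples (Fin k) (fun _ : Fin d => n), (lcs Y : ℝ) := by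
  rw [expectedLCS, ← Fintype.expect_eq_sum_div_card]
  refine expect_nbij (fun X i => List.ofFn (X i)) ?_ (fun _ _ => rfl) ?_ ?_
  · intro X _
    simp
  · intro X _ Y _ h
    exact funext fun i => List.ofFn_injective (congrFun h i)
  · intro Y hY
    rw [mem_coe, mem_tuples] at hY
    have h : ∀ i, ∃ x : Fin n → Fin k, List.ofFn x = Y i := fun i => by
      have : Y i ∈ words (Fin k) n := mem_words.2 (hY i)
      simpa [words] using this
    choose x hx using h
    exact ⟨x, mem_coe.2 (mem_univ _), funext hx⟩

variable [NeZero k] [NeZero d]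

theorem expectedLCS_le (n : ℕ) : expectedLCS k d n ≤ n := by
  rw [expectedLCS_eq_expect_tuples]
  refine expect_le (tuples_nonempty _) fun Y hY => ?_
  rw [mem_tuples] at hY
  rw [← hY 0]
  exact_mod_cast lcs_le_length Y 0

theorem expectedLCS_add_le (m n : ℕ) :
    expectedLCS k d m + expectedLCS k d n ≤ expectedLCS k d (m + n) := by
  simp only [expectedLCS_eq_expect_tuples]
  rw [expect_tuples_append (fun _ => m) (fun _ => n)]
  calc _ = 𝔼 X ∈ tuples (Fin k) (fun _ : Fin d => m),
        𝔼 Y ∈ tuples (Fin k) (fun _ : Fin d => n), ((lcs X : ℝ) + lcs Y) := by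
        simp only [expect_add_distrib, expect_const (tuples_nonempty _)]
    _ ≤ _ := expect_le_expect fun X _ => expect_le_expect fun Y _ => by
        exact_mod_cast lcs_add_le_lcs_append X Y

/-- The limit defining the generalized Chvátal–Sankoff constant exists. -/
theorem tendsto_expectedLCS_div :
    Tendsto (fun n : ℕ => expectedLCS k d n / (n : ℝ)) atTop (𝓝 (chvatalSankoff k d)) := by
  refine tendsto_nhds_limUnder ?_
  have hsub : Subadditive fun n => -expectedLCS k d n := fun m n => by
    linarith [expectedLCS_add_le k (d := d) m n]
  have hbdd : BddBelow (Set.range fun n : ℕ => -expectedLCS k d n / n) := by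
    refine ⟨-1, ?_⟩
    rintro _ ⟨n, rfl⟩
    have : expectedLCS k d n / n ≤ 1 := div_le_one_of_le₀ (expectedLCS_le k n) (by positivity)
    simp only [neg_div]
    linarith
  refine ⟨-hsub.lim, ?_⟩
  simpa [neg_div] using (hsub.tendsto_lim hbdd).neg

end ExpectedLCS

/-! ### Upper bound by counting superwords -/

section UpperBound

/-- The number of binary words of length `n` containing a given subsequence `w`, weighted by
`x ^ |w|` with `1 ≤ x`, is at most `(1 + x) ^ n`. -/
theorem card_superwords_mul_pow_le {x : ℝ} (hx : 1 ≤ x) (n : ℕ) (w : List (Fin 2)) :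
    (#{y ∈ words (Fin 2) n | w.Sublist y} : ℝ) * x ^ w.length ≤ (1 + x) ^ n := by
  induction n generalizing w with
  | zero =>
    cases w with
    | nil =>
      have : #{y ∈ words (Fin 2) 0 | List.Sublist [] y} ≤ 1 :=
        (card_filter_le _ _).trans (by simp [card_words])
      simpa using this
    | cons a w =>
      rw [filter_false_of_mem fun y hy h => by
        rw [mem_words, List.length_eq_zero_iff] at hy
        simp [hy] at h]
      simp
  | succ n ih =>
    cases w with
    | nil =>
      have h : #{y ∈ words (Fin 2) (n + 1) | List.Sublist [] y} ≤ 2 ^ (n + 1) :=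
        (card_filter_le _ _).trans (by simp [card_words])
      calc _ ≤ (2 : ℝ) ^ (n + 1) := by
            simpa using (by exact_mod_cast h :
              (#{y ∈ words (Fin 2) (n + 1) | List.Sublist [] y} : ℝ) ≤ 2 ^ (n + 1))
        _ ≤ _ := by gcongr; linarith
    | cons a w =>
      -- Split on the first letter of `y`: if it is `a`, it may be matched greedily; otherwise it is
      -- `1 - a` and is useless.
      have hsub : {y ∈ words (Fin 2) (n + 1) | (a :: w).Sublist y} ⊆
          ({y ∈ words (Fin 2) n | w.Sublist y}).image (a :: ·) ∪
            ({y ∈ words (Fin 2) n | (a :: w).Sublist y}).image ((1 - a) :: ·) := by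
        intro y hy
        simp only [mem_filter, mem_words] at hy
        obtain ⟨hlen, hs⟩ := hy
        obtain ⟨b, y, rfl⟩ : ∃ b z, y = b :: z :=
          List.exists_cons_of_ne_nil (by rintro rfl; simp at hlen)
        simp only [List.length_cons, Nat.add_right_cancel_iff] at hlen
        simp only [mem_union, mem_image, mem_filter, mem_words]
        by_cases hb : b = a
        · subst hb
          exact Or.inl ⟨y, ⟨hlen, List.cons_sublist_cons.1 hs⟩, rfl⟩
        · refine Or.inr ⟨y, ⟨hlen, ?_⟩, ?_⟩
          · cases hs with
            | cons _ h => exact h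
            | cons_cons _ h => exact absurd rfl hb
          · congr 1
            exact (by decide : ∀ a b : Fin 2, ¬b = a → 1 - a = b) _ _ hb
      have hcard : (#{y ∈ words (Fin 2) (n + 1) | (a :: w).Sublist y} : ℝ) ≤
          #{y ∈ words (Fin 2) n | w.Sublist y} +
            #{y ∈ words (Fin 2) n | (a :: w).Sublist y} := by
        exact_mod_cast (card_le_card hsub).trans ((card_union_le _ _).trans
          (add_le_add card_image_le card_image_le))
      have h1 := ih w
      have h2 := ih (a :: w)
      have hx0 : 0 ≤ x ^ (a :: w).length := by positivity
      calc _ ≤ ((#{y ∈ words (Fin 2) n | w.Sublist y} : ℝ) +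
            #{y ∈ words (Fin 2) n | (a :: w).Sublist y}) * x ^ (a :: w).length := by gcongr
        _ = x * (#{y ∈ words (Fin 2) n | w.Sublist y} * x ^ w.length) +
            #{y ∈ words (Fin 2) n | (a :: w).Sublist y} * x ^ (a :: w).length := by
          rw [List.length_cons, pow_succ]
          ring
        _ ≤ x * (1 + x) ^ n + (1 + x) ^ n := by gcongr
        _ = _ := by ring

/-- A union bound over all potential common subsequences of length `m`. -/
theorem card_le_lcs_mul_pow_le {x : ℝ} (hx : 1 ≤ x) (d n m : ℕ) [NeZero d] :
    (#{Y ∈ tuples (Fin 2) (fun _ : Fin d => n) | m ≤ lcs Y} : ℝ) * (x ^ m) ^ d ≤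
      2 ^ m * ((1 + x) ^ n) ^ d := by
  have hsub : {Y ∈ tuples (Fin 2) (fun _ : Fin d => n) | m ≤ lcs Y} ⊆
      (words (Fin 2) m).biUnion fun w =>
        Fintype.piFinset fun _ : Fin d => {y ∈ words (Fin 2) n | w.Sublist y} := by
    intro Y hY
    rw [mem_filter, mem_tuples, le_lcs_iff] at hY
    obtain ⟨hlen, w, hw, hs⟩ := hY
    simp only [mem_biUnion, Fintype.mem_piFinset, mem_filter, mem_words]
    exact ⟨w, hw, fun i => ⟨hlen i, hs i⟩⟩
  have hcard : (#{Y ∈ tuples (Fin 2) (fun _ : Fin d => n) | m ≤ lcs Y} : ℝ) ≤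
      ∑ w ∈ words (Fin 2) m, (#{y ∈ words (Fin 2) n | w.Sublist y} : ℝ) ^ d := by
    have := (card_le_card hsub).trans card_biUnion_le
    simp only [Fintype.card_piFinset_const] at this
    exact_mod_cast this
  calc _ ≤ (∑ w ∈ words (Fin 2) m, (#{y ∈ words (Fin 2) n | w.Sublist y} : ℝ) ^ d) *
        (x ^ m) ^ d := by gcongr
    _ = ∑ w ∈ words (Fin 2) m, ((#{y ∈ words (Fin 2) n | w.Sublist y} : ℝ) * x ^ m) ^ d := by
      simp only [sum_mul, mul_pow]
    _ ≤ ∑ w ∈ words (Fin 2) m, ((1 + x) ^ n) ^ d := by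
      refine sum_le_sum fun w hw => ?_
      gcongr
      rw [← mem_words.1 hw]
      exact card_superwords_mul_pow_le hx n w
    _ = _ := by simp [card_words]

theorem card_tuples_const (d n : ℕ) :
    #(tuples (Fin 2) (fun _ : Fin d => n)) = (2 ^ n) ^ d := by
  simp [tuples, card_words]

/-- The LCS is at most `m` off the event `m ≤ lcs Y` and at most `n` on it; the union bound controls
the probability of the event. -/
theorem expectedLCS_le_add {x : ℝ} (hx : 1 ≤ x) (d n m : ℕ) [NeZero d] :
    expectedLCS 2 d n ≤ m + n * (2 ^ m * (((1 + x) / 2) ^ n / x ^ m) ^ d) := by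
  have hx0 : 0 < x := by linarith
  set T := tuples (Fin 2) (fun _ : Fin d => n) with hT
  have hpt : ∀ Y ∈ T, (lcs Y : ℝ) ≤ m + n * (if m ≤ lcs Y then 1 else 0) := by
    intro Y hY
    split_ifs with h
    · have := lcs_le_length Y 0
      rw [mem_tuples.1 hY 0] at this
      have : (lcs Y : ℝ) ≤ n := by exact_mod_cast this
      have : (0 : ℝ) ≤ m := by positivity
      linarith
    · have : (lcs Y : ℝ) ≤ m := by exact_mod_cast (not_le.1 h).le
      linarith
  rw [expectedLCS_eq_expect_tuples]
  refine (expect_le_expect hpt).trans ?_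
  rw [expect_add_distrib, expect_const (tuples_nonempty _), ← mul_expect]
  gcongr
  rw [expect_eq_sum_div_card, sum_boole, hT, card_tuples_const]
  have := card_le_lcs_mul_pow_le hx d n m
  rw [div_pow, div_pow, div_pow]
  push_cast
  rw [div_le_iff₀ (by positivity)]
  calc _ = (#{Y ∈ T | m ≤ lcs Y} : ℝ) * (x ^ m) ^ d / (x ^ m) ^ d := by
        rw [← hT]
        field_simp
    _ ≤ 2 ^ m * ((1 + x) ^ n) ^ d / (x ^ m) ^ d := by gcongr
    _ = _ := by field_simp

theorem chvatalSankoff_two_le (d : ℕ) (hd : 2 ≤ d) :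
    chvatalSankoff 2 d ≤ 1 / 2 + 1 / Real.sqrt d := by
  have : NeZero d := ⟨by omega⟩
  have hd' : (2 : ℝ) ≤ d := by exact_mod_cast hd
  set s := Real.sqrt d with hs
  have hss : s ^ 2 = d := Real.sq_sqrt (by positivity)
  have hs0 : 0 ≤ s := Real.sqrt_nonneg _
  have hs1 : 1 < s := by nlinarith
  set ρ : ℝ := 1 / 2 + 1 / s with hρ
  have hρ0 : 0 ≤ ρ := by positivity
  have hl := Real.log_two_lt_d9
  have hl0 := Real.log_pos one_lt_two
  have key : ∀ n : ℕ, 0 < n → expectedLCS 2 d n / n ≤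
      (⌈ρ * n⌉₊ : ℝ) / n + Real.exp (-(1 / 2 : ℝ)) ^ n := by
    intro n hn
    have hn' : (0 : ℝ) < n := by exact_mod_cast hn
    set m := ⌈ρ * n⌉₊ with hm
    have hmρ : ρ * n ≤ m := Nat.le_ceil _
    have h := expectedLCS_le_add (Real.one_le_exp (by positivity : 0 ≤ 4 / s)) d n m
    rw [div_le_iff₀ hn', add_mul, div_mul_cancel₀ _ hn'.ne', mul_comm _ (n : ℝ)]
    refine h.trans ?_
    gcongr
    -- Write the left side as `exp y * cosh y` with `y = 2 / s`.
    have hcosh : (1 + Real.exp (4 / s)) / 2 ≤ Real.exp (2 / s + 2 / s ^ 2) := by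
      have := Real.cosh_le_exp_half_sq (2 / s)
      rw [Real.cosh_eq] at this
      calc (1 + Real.exp (4 / s)) / 2
          = Real.exp (2 / s) * ((Real.exp (2 / s) + Real.exp (-(2 / s))) / 2) := by
            have e1 : Real.exp (4 / s) = Real.exp (2 / s) * Real.exp (2 / s) := by
              rw [← Real.exp_add]; ring_nf
            have e2 : Real.exp (2 / s) * Real.exp (-(2 / s)) = 1 := by
              rw [← Real.exp_add]; simp
            rw [e1]
            linear_combination -(1 / 2) * e2
        _ ≤ Real.exp (2 / s) * Real.exp ((2 / s) ^ 2 / 2) := by gcongr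
        _ = _ := by rw [← Real.exp_add]; ring_nf
    calc (2 : ℝ) ^ m * (((1 + Real.exp (4 / s)) / 2) ^ n / Real.exp (4 / s) ^ m) ^ d
        ≤ 2 ^ m * (Real.exp (2 / s + 2 / s ^ 2) ^ n / Real.exp (4 / s) ^ m) ^ d := by gcongr
      _ = Real.exp (m * (Real.log 2 - 4 * s) + n * (2 * s + 2)) := by
        rw [← Real.exp_nat_mul, ← Real.exp_nat_mul, ← Real.exp_sub, ← Real.exp_nat_mul]
        nth_rewrite 1 [← Real.exp_log (by norm_num : (0 : ℝ) < 2)]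
        rw [← Real.exp_nat_mul, ← Real.exp_add, ← hss]
        congr 1
        field_simp
        ring
      _ ≤ Real.exp (n * (-(1 / 2))) := by
        rw [Real.exp_le_exp]
        have h1 : (m : ℝ) * (Real.log 2 - 4 * s) ≤ ρ * n * (Real.log 2 - 4 * s) :=
          mul_le_mul_of_nonpos_right hmρ (by linarith)
        -- Since `4 s ρ = 2 s + 4`, the terms in `s` cancel and `ρ log 2 - 2` remains.
        have h2 : ρ * (Real.log 2 - 4 * s) + (2 * s + 2) ≤ -(1 / 2) := by
          have e : ρ * (4 * s) = 2 * s + 4 := by rw [hρ]; field_simp; ring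
          have : ρ ≤ 3 / 2 := by
            have : 1 / s ≤ 1 := by rw [div_le_one (by linarith)]; exact hs1.le
            linarith
          nlinarith
        nlinarith
      _ = _ := by rw [Real.exp_nat_mul]
  have hlim : Tendsto (fun n : ℕ => (⌈ρ * n⌉₊ : ℝ) / n + Real.exp (-(1 / 2 : ℝ)) ^ n) atTop
      (𝓝 (ρ + 0)) := by
    refine Tendsto.add ?_ ?_
    · exact (tendsto_nat_ceil_mul_div_atTop hρ0).comp tendsto_natCast_atTop_atTop
    · exact tendsto_pow_atTop_nhds_zero_of_lt_one (Real.exp_nonneg _) (by simp)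
  rw [add_zero] at hlim
  refine le_of_tendsto_of_tendsto (tendsto_expectedLCS_div 2) hlim ?_
  filter_upwards [eventually_gt_atTop 0] with n hn using key n hn

end UpperBound

/-! ### Bias of a random letter towards the majority -/

section Majority

/-- The sign attached to a binary letter. -/
noncomputable def letterSign (a : Fin 2) : ℝ := if a = 1 then 1 else -1

/-- The excess of ones over zeros in a family of binary letters. -/
noncomputable def signSum {d : ℕ} (b : Fin d → Fin 2) : ℝ := ∑ i, letterSign (b i)

/-- The letter occurring most often in a family of binary letters; ties are broken in favour of
`1`. -/
noncomputable def majority {d : ℕ} (b : Fin d → Fin 2) : Fin 2 := if 0 ≤ signSum b then 1 else 0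

variable {d : ℕ}

theorem expect_fin_succ_pi (f : (Fin (d + 1) → Fin 2) → ℝ) :
    𝔼 b, f b = (𝔼 b, f (Fin.cons 0 b) + 𝔼 b, f (Fin.cons 1 b)) / 2 := by
  rw [← Fintype.expect_equiv (Fin.consEquiv fun _ => Fin 2) (fun p => f (Fin.cons p.1 p.2)) f
    (fun p => rfl), ← univ_product_univ, expect_product, Fintype.expect_eq_sum_div_card,
    Fin.sum_univ_two]
  simp

theorem signSum_cons (a : Fin 2) (b : Fin d → Fin 2) :
    signSum (Fin.cons a b : Fin (d + 1) → Fin 2) = letterSign a + signSum b := by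
  simp [signSum, Fin.sum_univ_succ]

theorem expect_signSum_sq (d : ℕ) : 𝔼 b : Fin d → Fin 2, signSum b ^ 2 = d := by
  induction d with
  | zero => simp [signSum]
  | succ d ih =>
    simp only [expect_fin_succ_pi, signSum_cons]
    rw [← expect_add_distrib]
    have h : ∀ b : Fin d → Fin 2, (letterSign 0 + signSum b) ^ 2 + (letterSign 1 + signSum b) ^ 2 =
        2 * signSum b ^ 2 + 2 := fun b => by simp [letterSign]; ring
    simp only [h]
    rw [expect_add_distrib, ← mul_expect, ih, Fintype.expect_const]
    push_cast
    ring

theorem expect_signSum_pow_four (d : ℕ) :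
    𝔼 b : Fin d → Fin 2, signSum b ^ 4 = 3 * d ^ 2 - 2 * d := by
  induction d with
  | zero => simp [signSum]
  | succ d ih =>
    simp only [expect_fin_succ_pi, signSum_cons]
    rw [← expect_add_distrib]
    have h : ∀ b : Fin d → Fin 2, (letterSign 0 + signSum b) ^ 4 + (letterSign 1 + signSum b) ^ 4 =
        2 * signSum b ^ 4 + 12 * signSum b ^ 2 + 2 := fun b => by simp [letterSign]; ring
    simp only [h]
    rw [expect_add_distrib, expect_add_distrib, ← mul_expect, ← mul_expect, ih,
      expect_signSum_sq, Fintype.expect_const]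
    push_cast
    ring

/-- A Khinchine inequality: the mean absolute value of a sum of `d` independent random signs is
of order at least `√d`. -/
theorem le_expect_abs_signSum (hd : 0 < d) :
    2 / 9 * Real.sqrt d ≤ 𝔼 b : Fin d → Fin 2, |signSum b| := by
  set s := Real.sqrt d with hs
  have hd' : (0 : ℝ) < d := by exact_mod_cast hd
  have hss : s ^ 2 = d := Real.sq_sqrt (by positivity)
  have hs0 : 0 < s := Real.sqrt_pos.2 hd'
  -- Fourth-moment method: bound `|u|` below by an even quartic whose mean is explicit. After
  -- scaling `u = 3 s v` it reads `v ^ 2 - v ^ 4 ≤ v`.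
  have hpt : ∀ b : Fin d → Fin 2,
      1 / (3 * s) * signSum b ^ 2 - 1 / (27 * s ^ 3) * signSum b ^ 4 ≤ |signSum b| := by
    intro b
    set u := |signSum b| with hu
    have hu0 : 0 ≤ u := abs_nonneg _
    have h2 : signSum b ^ 2 = u ^ 2 := (sq_abs _).symm
    have h4 : signSum b ^ 4 = u ^ 4 := by
      rw [show 4 = 2 * 2 from rfl, pow_mul, h2, ← pow_mul]
    rw [h2, h4]
    obtain ⟨v, hv⟩ : ∃ v, u = 3 * s * v := ⟨u / (3 * s), by field_simp⟩
    have hv0 : 0 ≤ v := by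
      by_contra h
      nlinarith
    rw [hv]
    have e : 1 / (3 * s) * (3 * s * v) ^ 2 - 1 / (27 * s ^ 3) * (3 * s * v) ^ 4 =
        3 * s * (v ^ 2 - v ^ 4) := by field_simp; ring
    rw [e]
    have : v ^ 2 - v ^ 4 ≤ v := by
      have h1 : 0 ≤ 1 - v + v ^ 3 := by
        nlinarith [sq_nonneg (v - 1), mul_nonneg hv0 (sq_nonneg (v - 1))]
      nlinarith
    gcongr
  have h := expect_le_expect (s := (univ : Finset (Fin d → Fin 2))) fun b _ => hpt b
  rw [expect_sub_distrib, ← mul_expect, ← mul_expect, expect_signSum_sq,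
    expect_signSum_pow_four] at h
  refine le_trans ?_ h
  rw [← hss]
  have : 1 / (3 * s) * s ^ 2 - 1 / (27 * s ^ 3) * (3 * (s ^ 2) ^ 2 - 2 * s ^ 2) =
      2 / 9 * s + 2 / (27 * s) := by field_simp; ring
  rw [this]
  have : 0 ≤ 2 / (27 * s) := by positivity
  linarith

theorem letterSign_mul (a b : Fin 2) : letterSign a * letterSign b = if a = b then 1 else -1 := by
  fin_cases a <;> fin_cases b <;> simp [letterSign]

theorem letterSign_majority_mul_signSum (b : Fin d → Fin 2) :
    letterSign (majority b) * signSum b = |signSum b| := by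
  unfold majority
  split_ifs with h
  · simp [letterSign, abs_of_nonneg h]
  · simp [letterSign, abs_of_neg (not_le.1 h)]

theorem signSum_comp_perm (b : Fin d → Fin 2) (e : Equiv.Perm (Fin d)) :
    signSum (b ∘ e) = signSum b :=
  Equiv.sum_comp e fun i => letterSign (b i)

theorem majority_comp_perm (b : Fin d → Fin 2) (e : Equiv.Perm (Fin d)) :
    majority (b ∘ e) = majority b := by
  simp only [majority, signSum_comp_perm]

theorem expect_majority_agreement_symm (i j : Fin d) :
    𝔼 b : Fin d → Fin 2, letterSign (majority b) * letterSign (b i) =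
      𝔼 b : Fin d → Fin 2, letterSign (majority b) * letterSign (b j) := by
  refine Fintype.expect_equiv (Equiv.arrowCongr (Equiv.swap i j) (Equiv.refl _)) _ _ fun b => ?_
  have : (Equiv.arrowCongr (Equiv.swap i j) (Equiv.refl (Fin 2))) b = b ∘ Equiv.swap i j := by
    ext; simp [Equiv.arrowCongr]
  rw [this, majority_comp_perm]
  simp

/-- Each letter of a random binary family agrees with the majority with probability exceeding
`1 / 2` by at least a constant times `1 / √d`. -/
theorem le_expect_majority_agreement (i : Fin d) :
    2 / (9 * Real.sqrt d) ≤ 𝔼 b : Fin d → Fin 2, letterSign (majority b) * letterSign (b i) := by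
  have hd : 0 < d := i.pos
  have hd' : (0 : ℝ) < d := by exact_mod_cast hd
  -- The agreements sum to `|signSum b|`, and by symmetry every index has an equal share of the
  -- mean.
  have h1 : ∑ j : Fin d, 𝔼 b : Fin d → Fin 2, letterSign (majority b) * letterSign (b j) =
      𝔼 b : Fin d → Fin 2, |signSum b| := by
    rw [← expect_sum_comm]
    refine expect_congr rfl fun b _ => ?_
    rw [← mul_sum, ← letterSign_majority_mul_signSum, signSum]
  rw [sum_congr rfl fun j _ => expect_majority_agreement_symm j i, sum_const, card_univ,
    Fintype.card_fin, nsmul_eq_mul] at h1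
  have h2 := le_expect_abs_signSum hd
  rw [← h1] at h2
  have hss : Real.sqrt d ^ 2 = d := Real.sq_sqrt (by positivity)
  have hs0 : 0 < Real.sqrt d := Real.sqrt_pos.2 hd'
  rw [div_le_iff₀ (by positivity)]
  have h3 : 2 / 9 * Real.sqrt d * Real.sqrt d ≤
      d * (𝔼 b : Fin d → Fin 2, letterSign (majority b) * letterSign (b i)) * Real.sqrt d := by
    gcongr
  have h4 : 2 / 9 * (d : ℝ) ≤
      d * ((𝔼 b : Fin d → Fin 2, letterSign (majority b) * letterSign (b i)) * Real.sqrt d) := by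
    calc 2 / 9 * (d : ℝ) = 2 / 9 * Real.sqrt d * Real.sqrt d := by linear_combination -(2 / 9) * hss
      _ ≤ _ := h3.trans_eq (by ring)
  nlinarith

/-- The mean cost of matching one letter against the majority, when a mismatch costs `K`. -/
theorem expect_majority_cost_le {K : ℝ} (hK : 1 ≤ K) (i : Fin d) :
    𝔼 b : Fin d → Fin 2, (if b i ≠ majority b then K else 1) ≤
      (1 / 2 + 1 / (9 * Real.sqrt d)) + (1 / 2 - 1 / (9 * Real.sqrt d)) * K := by
  have h : ∀ b : Fin d → Fin 2, (if b i ≠ majority b then K else 1) =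
      (1 + K) / 2 - (K - 1) / 2 * (letterSign (majority b) * letterSign (b i)) := by
    intro b
    rw [letterSign_mul]
    by_cases hb : b i = majority b
    · simp only [hb, ne_eq, not_true_eq_false, if_false, if_true]; ring
    · simp only [hb, Ne.symm hb, ne_eq, not_false_eq_true, if_false, if_true]; ring
  simp only [h]
  rw [expect_sub_distrib, ← mul_expect, Fintype.expect_const]
  have h1 := mul_le_mul_of_nonneg_left (le_expect_majority_agreement i)
    (by linarith : 0 ≤ (K - 1) / 2)
  refine (sub_le_sub_left h1 _).trans_eq ?_
  ring

end Majority

/-! ### Greedy majority matching and its potential -/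

section MajorityMatching

/-- The words in the family `Y` have a common subsequence of length `r`, where the words with
index in `W` have to provide an additional letter `a` in front of it. -/
def HasPrefixedCommon {ι α : Type*} (W : Set ι) (a : α) (r : ℕ) (Y : ι → List α) : Prop :=
  ∃ w : List α, w.length = r ∧ ∀ i, w.Sublist (Y i) ∧ (i ∈ W → (a :: w).Sublist (Y i))

namespace HasPrefixedCommon

variable {ι α : Type*} {W : Set ι} {a : α} {r : ℕ} {Y : ι → List α}

theorem zero_empty : HasPrefixedCommon ∅ a 0 Y :=
  ⟨[], rfl, fun _ => ⟨List.nil_sublist _, False.elim⟩⟩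

theorem cons_update [DecidableEq ι] (i : ι) (h : HasPrefixedCommon (W \ {i}) a r Y) :
    HasPrefixedCommon W a r (Function.update Y i (a :: Y i)) := by
  obtain ⟨w, hw, hY⟩ := h
  refine ⟨w, hw, fun j => ?_⟩
  rcases eq_or_ne j i with rfl | hj
  · rw [Function.update_self]
    exact ⟨(hY j).1.cons a, fun _ => (hY j).1.cons_cons a⟩
  · rw [Function.update_of_ne hj]
    exact ⟨(hY j).1, fun h => (hY j).2 ⟨h, hj⟩⟩

theorem update_cons [DecidableEq ι] (i : ι) (b : α) (h : HasPrefixedCommon W a r Y) :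
    HasPrefixedCommon W a r (Function.update Y i (b :: Y i)) := by
  obtain ⟨w, hw, hY⟩ := h
  refine ⟨w, hw, fun j => ?_⟩
  rcases eq_or_ne j i with rfl | hj
  · rw [Function.update_self]
    exact ⟨(hY j).1.cons b, fun h => ((hY j).2 h).cons b⟩
  · rw [Function.update_of_ne hj]
    exact hY j

/-- One round of matching: words starting with `a` spend that letter, the others discard theirs and
become pending. With no word pending, the letter `c` is irrelevant. -/
theorem cons_of_ne {b : ι → α} (c : α) (h : HasPrefixedCommon {i | b i ≠ a} a r Y) :
    HasPrefixedCommon ∅ c (r + 1) (fun i => b i :: Y i) := by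
  obtain ⟨w, hw, hY⟩ := h
  refine ⟨a :: w, by simp [hw], fun i => ⟨?_, False.elim⟩⟩
  by_cases hb : b i = a
  · exact hb ▸ (hY i).1.cons_cons _
  · exact ((hY i).2 hb).cons _

end HasPrefixedCommon

open Classical in
/-- The probability that uniformly random binary words of lengths `n` do not satisfy
`HasPrefixedCommon W a r`. -/
noncomputable def failureProb {d : ℕ} (W : Set (Fin d)) (a : Fin 2) (r : ℕ) (n : Fin d → ℕ) : ℝ :=
  𝔼 Y ∈ tuples (Fin 2) n, if HasPrefixedCommon W a r Y then 0 else 1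

variable {d : ℕ}

theorem failureProb_le_one (W : Set (Fin d)) (a : Fin 2) (r : ℕ) (n : Fin d → ℕ) :
    failureProb W a r n ≤ 1 := by
  refine expect_le (tuples_nonempty _) fun Y _ => ?_
  split_ifs <;> norm_num

theorem failureProb_zero_empty (a : Fin 2) (n : Fin d → ℕ) : failureProb ∅ a 0 n = 0 := by
  simp [failureProb, HasPrefixedCommon.zero_empty]

/-- A pending word reads one letter: with probability `1/2` it is `a` and the word stops waiting. -/
theorem failureProb_le_of_pending (W : Set (Fin d)) (a : Fin 2) (r : ℕ) {n : Fin d → ℕ} {i : Fin d}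
    (hi : n i ≠ 0) :
    failureProb W a r n ≤ (failureProb (W \ {i}) a r (Function.update n i (n i - 1)) +
      failureProb W a r (Function.update n i (n i - 1))) / 2 := by
  classical
  set n' := Function.update n i (n i - 1)
  have h1 : 𝔼 Y ∈ tuples (Fin 2) n',
      (if HasPrefixedCommon W a r (Function.update Y i (a :: Y i)) then 0 else 1 : ℝ) ≤
        failureProb (W \ {i}) a r n' := by
    refine expect_le_expect fun Y _ => ?_
    split_ifs with h h' h' <;> first | exact absurd (h'.cons_update i) h | norm_num
  have h2 : ∀ b, 𝔼 Y ∈ tuples (Fin 2) n',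
      (if HasPrefixedCommon W a r (Function.update Y i (b :: Y i)) then 0 else 1 : ℝ) ≤
        failureProb W a r n' := by
    intro b
    refine expect_le_expect fun Y _ => ?_
    split_ifs with h h' h' <;> first | exact absurd (h'.update_cons i b) h | norm_num
  rw [failureProb, expect_tuples_cons_update hi, Fintype.expect_eq_sum_div_card, Fin.sum_univ_two,
    Fintype.card_fin, Nat.cast_ofNat]
  refine div_le_div_of_nonneg_right ?_ zero_le_two
  rcases (by decide : ∀ a : Fin 2, a = 0 ∨ a = 1) a with rfl | rfl
  · exact add_le_add h1 (h2 1)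
  · rw [add_comm]
    exact add_le_add h1 (h2 0)

theorem failureProb_empty_succ_le (c : Fin 2) (r : ℕ) (n : Fin d → ℕ) :
    failureProb ∅ c (r + 1) (fun i => n i + 1) ≤
      𝔼 b : Fin d → Fin 2, failureProb {i | b i ≠ majority b} (majority b) r n := by
  classical
  rw [failureProb, expect_tuples_cons]
  refine expect_le_expect fun b _ => expect_le_expect fun Y _ => ?_
  split_ifs with h h' h' <;> first | exact absurd (h'.cons_of_ne c) h | norm_num

open Classical in
/-- An exponential moment bound for the failure probability of the greedy majority matching. -/
theorem failureProb_le [NeZero d] {K M x : ℝ} (hx : 1 ≤ x) (hK : 1 ≤ K) (hM : 1 ≤ M)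
    (hxK : x * (1 + K) ≤ 2 * K)
    (hcost : ∀ i : Fin d, x * (𝔼 b : Fin d → Fin 2, if b i ≠ majority b then K else 1) ≤ M)
    (W : Set (Fin d)) (a : Fin 2) (r : ℕ) (n : Fin d → ℕ) :
    failureProb W a r n ≤ M ^ r * ∑ i, (if i ∈ W then K else 1) * x⁻¹ ^ n i := by
  have hx0 : 0 < x := by linarith
  induction hN : ∑ i, n i using Nat.strong_induction_on generalizing W a r n with
  | _ N ih =>
  subst hN
  have hnonneg : ∀ (W : Set (Fin d)) (n : Fin d → ℕ) (i : Fin d),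
      0 ≤ (if i ∈ W then K else 1) * x⁻¹ ^ n i := fun W n i => by
    split_ifs <;> positivity
  -- An exhausted word alone contributes at least `1` to the potential, so the bound is trivial.
  by_cases hzero : ∃ i, n i = 0
  · obtain ⟨i, hi⟩ := hzero
    refine (failureProb_le_one _ _ _ _).trans ?_
    have h1 : 1 ≤ (if i ∈ W then K else 1) * x⁻¹ ^ n i := by
      rw [hi, pow_zero, mul_one]
      split_ifs <;> simp [hK]
    have h2 := h1.trans (single_le_sum (fun j _ => hnonneg W n j) (mem_univ i))
    exact one_le_mul_of_one_le_of_one_le (one_le_pow₀ hM) h2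
  push Not at hzero
  rcases W.eq_empty_or_nonempty with rfl | ⟨i, hiW⟩
  · cases r with
    | zero =>
      rw [failureProb_zero_empty]
      exact mul_nonneg (by positivity) (sum_nonneg fun i _ => hnonneg _ _ i)
    | succ r =>
      obtain ⟨m, rfl⟩ : ∃ m : Fin d → ℕ, n = fun i => m i + 1 :=
        ⟨fun i => n i - 1, funext fun i => (Nat.succ_pred_eq_of_ne_zero (hzero i)).symm⟩
      refine (failureProb_empty_succ_le a r m).trans ?_
      have hlt : ∑ i, m i < ∑ i, (m i + 1) := by
        simp [sum_add_distrib, Nat.pos_of_neZero d]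
      calc 𝔼 b : Fin d → Fin 2, failureProb {i | b i ≠ majority b} (majority b) r m
          ≤ 𝔼 b : Fin d → Fin 2,
              M ^ r * ∑ i, (if b i ≠ majority b then K else 1) * x⁻¹ ^ m i :=
            expect_le_expect fun b _ => by
              refine (ih _ hlt {i | b i ≠ majority b} (majority b) r m rfl).trans_eq ?_
              congr!
        _ = M ^ r * ∑ i, (x * 𝔼 b : Fin d → Fin 2, if b i ≠ majority b then K else 1) *
              x⁻¹ ^ (m i + 1) := by
            rw [← mul_expect, expect_sum_comm]
            congr 1
            refine sum_congr rfl fun i _ => ?_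
            rw [← expect_mul, pow_succ]
            field_simp
        _ ≤ M ^ r * ∑ i, M * x⁻¹ ^ (m i + 1) := by
            gcongr with i
            exact hcost i
        _ = _ := by
            simp only [Set.mem_empty_iff_false, if_false, one_mul, ← mul_sum]
            ring
  · have hlt : ∑ j, Function.update n i (n i - 1) j < ∑ j, n j := by
      rw [← add_sum_erase _ _ (mem_univ i), ← add_sum_erase univ n (mem_univ i),
        Function.update_self, sum_congr rfl fun j hj => Function.update_of_ne (ne_of_mem_erase hj) _ _]
      have := hzero i
      omega
    refine (failureProb_le_of_pending W a r (hzero i)).trans ?_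
    have h1 := ih _ hlt (W \ {i}) a r _ rfl
    have h2 := ih _ hlt W a r _ rfl
    refine (div_le_div_of_nonneg_right (add_le_add h1 h2) zero_le_two).trans ?_
    rw [← mul_add, ← sum_add_distrib, mul_div_assoc, sum_div]
    gcongr with j
    rcases eq_or_ne j i with rfl | hj
    · obtain ⟨k, hk⟩ := Nat.exists_eq_succ_of_ne_zero (hzero j)
      simp only [Function.update_self, hk, Nat.succ_sub_one, Set.mem_sdiff, Set.mem_singleton_iff,
        not_true_eq_false, and_false, if_false, hiW, if_true, pow_succ]
      have hp : 0 < x⁻¹ ^ k := by positivity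
      -- The potential does not increase on average when a pending word reads a letter: its weight
      -- becomes `1` or `K` with equal probability.
      have : (1 + K) / 2 ≤ K * x⁻¹ := by
        rw [← div_eq_mul_inv, div_le_div_iff₀ two_pos hx0]
        linarith
      nlinarith
    · simp [hj]

end MajorityMatching

/-! ### From failure probabilities to the rate -/

section LowerBound

theorem le_expectedLCS_of_failureProb (d : ℕ) [NeZero d] (r n : ℕ) :
    r * (1 - failureProb (∅ : Set (Fin d)) 0 r (fun _ => n)) ≤ expectedLCS 2 d n := by
  classical
  rw [expectedLCS_eq_expect_tuples, failureProb, mul_sub, mul_one, mul_expect]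
  nth_rewrite 1 [← expect_const (tuples_nonempty (α := Fin 2) fun _ : Fin d => n) (r : ℝ)]
  rw [← expect_sub_distrib]
  refine expect_le_expect fun Y _ => ?_
  split_ifs with h
  · obtain ⟨w, rfl, hY⟩ := h
    simpa using length_le_lcs fun i => (hY i).1
  · simp

/-- If greedy majority matching has exponential moment `M` per step at base `x`, every rate `ρ`
with `M ^ ρ < x` is achieved. -/
theorem le_chvatalSankoff_of_cost {d : ℕ} [NeZero d] {K M x ρ : ℝ} (hx : 1 ≤ x) (hK : 1 ≤ K)
    (hM : 1 ≤ M) (hxK : x * (1 + K) ≤ 2 * K)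
    (hcost : ∀ i : Fin d, x * (𝔼 b : Fin d → Fin 2, if b i ≠ majority b then K else 1) ≤ M)
    (hρ : 0 ≤ ρ) (hρM : ρ * Real.log M < Real.log x) :
    ρ ≤ chvatalSankoff 2 d := by
  have hx0 : 0 < x := by linarith
  have hM0 : 0 < M := by linarith
  set q := Real.exp (ρ * Real.log M - Real.log x) with hq
  have key : ∀ n : ℕ, (⌊ρ * n⌋₊ : ℝ) / n * (1 - d * q ^ n) ≤ expectedLCS 2 d n / n := by
    intro n
    set r := ⌊ρ * n⌋₊ with hr
    rw [div_mul_eq_mul_div]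
    gcongr
    refine le_trans ?_ (le_expectedLCS_of_failureProb d r n)
    gcongr
    refine (failureProb_le hx hK hM hxK hcost _ _ _ _).trans ?_
    simp only [Set.mem_empty_iff_false, if_false, one_mul, sum_const, card_univ, Fintype.card_fin,
      nsmul_eq_mul]
    rw [mul_left_comm]
    gcongr
    calc M ^ r * x⁻¹ ^ n = Real.exp (r * Real.log M + n * -Real.log x) := by
          rw [Real.exp_add, Real.exp_nat_mul, Real.exp_nat_mul, Real.exp_log hM0, Real.exp_neg,
            Real.exp_log hx0]
      _ ≤ Real.exp (n * (ρ * Real.log M - Real.log x)) := by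
          rw [Real.exp_le_exp]
          have h1 : (r : ℝ) ≤ ρ * n := Nat.floor_le (by positivity)
          have h2 := mul_le_mul_of_nonneg_right h1 (Real.log_nonneg hM)
          linarith
      _ = q ^ n := Real.exp_nat_mul _ _
  have hlim : Tendsto (fun n : ℕ => (⌊ρ * n⌋₊ : ℝ) / n * (1 - d * q ^ n)) atTop
      (𝓝 (ρ * (1 - d * 0))) := by
    refine Tendsto.mul ((tendsto_nat_floor_mul_div_atTop hρ).comp tendsto_natCast_atTop_atTop)
      (tendsto_const_nhds.sub (tendsto_const_nhds.mul ?_))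
    refine tendsto_pow_atTop_nhds_zero_of_lt_one (Real.exp_nonneg _) ?_
    rw [hq, Real.exp_lt_one_iff]
    linarith
  simpa using le_of_tendsto_of_tendsto' hlim (tendsto_expectedLCS_div 2) key

/-- Choosing the base `1 + ε / 4` for bias `ε` makes the rate `1 / 2 + ε / 4` achievable. -/
theorem rate_mul_log_lt {ε : ℝ} (h0 : 0 < ε) (h1 : ε ≤ 1 / 2) :
    (1 / 2 + ε / 4) * Real.log ((1 + ε / 4) * (1 - 2 * ε * (ε / 4)) / (1 - ε / 4)) <
      Real.log (1 + ε / 4) := by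
  obtain ⟨t, rfl⟩ : ∃ t, ε = 4 * t := ⟨ε / 4, by ring⟩
  rw [mul_div_cancel_left₀ t (four_ne_zero' ℝ)]
  have ht0 : 0 < t := by linarith
  have ht1 : t ≤ 1 / 8 := by linarith
  have hprod : 0 < 1 - 2 * (4 * t) * t := by nlinarith
  have ha : Real.log (1 - 2 * (4 * t) * t) ≤ -(2 * (4 * t) * t) := by
    linarith [Real.log_le_sub_one_of_pos hprod]
  have hb : -Real.log (1 - t) ≤ t / (1 - t) := by
    have := Real.one_sub_inv_le_log_of_pos (by linarith : 0 < 1 - t)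
    have e : t / (1 - t) = (1 - t)⁻¹ - 1 := by
      have : 1 - t ≠ 0 := by linarith
      field_simp
      ring
    linarith
  have hb' : t / (1 - t) ≤ t + 8 / 7 * t ^ 2 := by
    rw [div_le_iff₀ (by linarith)]
    nlinarith
  have hc : t - t ^ 2 ≤ Real.log (1 + t) := by
    have := Real.one_sub_inv_le_log_of_pos (by linarith : 0 < 1 + t)
    have e : t - t ^ 2 ≤ 1 - (1 + t)⁻¹ := by
      have : 1 - (1 + t)⁻¹ = t / (1 + t) := by
        have : 1 + t ≠ 0 := by linarith
        field_simp
        ring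
      rw [this, le_div_iff₀ (by linarith)]
      nlinarith [pow_pos ht0 3]
    linarith
  rw [Real.log_div (by positivity) (by linarith), Real.log_mul (by positivity) hprod.ne']
  have h2 : Real.log (1 + t) + Real.log (1 - 2 * (4 * t) * t) - Real.log (1 - t) ≤
      Real.log (1 + t) - 2 * (4 * t) * t + (t + 8 / 7 * t ^ 2) := by linarith
  refine (mul_le_mul_of_nonneg_left h2 (by linarith)).trans_lt ?_
  have h3 := mul_le_mul_of_nonneg_left hc (by linarith : 0 ≤ 1 / 2 - t)
  -- After moving the `log (1 + t)` terms to the right, both sides start with `t / 2`; the `t ^ 2`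
  -- coefficients are `-17/7` on the left and `-3/2` on the right.
  nlinarith [pow_pos ht0 2, pow_pos ht0 3]

theorem le_chvatalSankoff_two (d : ℕ) (hd : 2 ≤ d) :
    1 / 2 + 1 / 36 / Real.sqrt d ≤ chvatalSankoff 2 d := by
  have : NeZero d := ⟨by omega⟩
  have hd' : (2 : ℝ) ≤ d := by exact_mod_cast hd
  set ε : ℝ := 1 / (9 * Real.sqrt d) with hε
  have hs : 1 ≤ Real.sqrt d := by rw [Real.one_le_sqrt]; linarith
  have h0 : 0 < ε := by positivity
  have h1 : ε ≤ 1 / 2 := by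
    rw [hε]
    exact one_div_le_one_div_of_le two_pos (by linarith)
  have ht : 0 < 1 - ε / 4 := by linarith
  have ht' : 4 - ε ≠ 0 := (by linarith : 0 < 4 - ε).ne'
  have hK : 1 ≤ (1 + ε / 4) / (1 - ε / 4) := by
    rw [le_div_iff₀ ht]
    linarith
  have e : 1 / 2 + 1 / 36 / Real.sqrt d = 1 / 2 + ε / 4 := by
    rw [hε]
    field_simp
    ring
  rw [e]
  -- Here `K = x / (2 - x)` is the mean of `x ^ G` for the geometric waiting time `G` of a pending
  -- word, so `x * (1 + K) = 2 * K` exactly.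
  refine le_chvatalSankoff_of_cost (x := 1 + ε / 4) (by linarith) hK ?_ ?_ (fun i => ?_)
    (by positivity) (rate_mul_log_lt h0 h1)
  · rw [le_div_iff₀ ht]
    nlinarith [pow_pos h0 3]
  · apply le_of_eq
    field_simp
    ring
  · refine (mul_le_mul_of_nonneg_left (expect_majority_cost_le hK i) (by linarith)).trans_eq ?_
    rw [← hε]
    field_simp
    ring

end LowerBound

theorem theorem1 :
    ∃ c₁ c₂ : ℝ, 0 < c₁ ∧ c₁ < c₂ ∧
      ∀ d : ℕ, 2 ≤ d →
        Tendsto (fun n : ℕ => expectedLCS 2 d n / (n : ℝ)) atTop (𝓝 (chvatalSankoff 2 d)) ∧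
        1 / 2 + c₁ / Real.sqrt (d : ℝ) ≤ chvatalSankoff 2 d ∧
        chvatalSankoff 2 d ≤ 1 / 2 + c₂ / Real.sqrt (d : ℝ) := by
  refine ⟨1 / 36, 1, by norm_num, by norm_num, fun d hd => ?_⟩
  have : NeZero d := ⟨by omega⟩
  exact ⟨tendsto_expectedLCS_div 2, le_chvatalSankoff_two d hd, chvatalSankoff_two_le d hd⟩
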